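/- Let $\mathbb T^1=\mathbb R/2\pi\mathbb Z$ and let $M=[-\pi,\pi]\times\mathbb T^1$, with variables $(z,\theta)$, be endowed with the warped product metric $$g(z,\theta)=dz^2+R(z)^2\,d\theta^2 ,$$ where $R:[-\pi,\pi]\to\mathbb R$ is smooth and satisfies $$R(-z)=R(z),\qquad R(z)>0\ \text{ for all } z\in[0,\pi],\qquad R(0)=1,\qquad R(\tfrac{\pi}{2})=\sqrt5,\qquad R(\pi)=\tfrac{1}{\sqrt2}.$$ Let $\Sigma=\{z=0\}\subset M$, with unit normal $\partial_\nu=\partial_z$; let $\Delta$ be the Laplace–Beltrami operator of $g$, and let $L^2(M)$ and $L^2(\Sigma)$ be taken with respect to the Riemannian measures of $g$ and of the induced metric. Then there exist $C,c>0$, sequences of real numbers $\lambda_j^e\to+\infty$ and $\lambda_j^o\to+\infty$, and sequences of complex-valued functions $\phi_j^e,\phi_j^o$ on $M$, smooth up to the boundary, with $\phi_j^e$ even and $\phi_j^o$ odd in $z$, such that for all $j$ and for each superscript $\bullet\in\{e,o\}$ $$(-\Delta-(\lambda_j^\bullet)^2)\phi_j^\bullet=0,\qquad \|\phi_j^\bullet\|_{L^2(M)}=1,\qquad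 \phi_j^\bullet|_{z=\pm\pi}=0,$$ and $$\partial_\nu\phi_j^e|_\Sigma=0,\quad \|\phi_j^e|_\Sigma\|_{L^2(\Sigma)}\le Ce^{-c\lambda_j^e},\qquad\text{and}\qquad \phi_j^o|_\Sigma=0,\quad \|\partial_\nu\phi_j^o|_\Sigma\|_{L^2(\Sigma)}\le Ce^{-c\lambda_j^o}.$$ -/

import Mathlib

open MeasureTheory Filter Topology
open scoped ContDiff

noncomputable section

namespace WarpedCylinder

/-- The Laplace-Beltrami operator in local coordinates `x = (x₀, …, x_{n-1})` of a Riemannian metric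
with coefficient matrix `g x`:
`Δ_g f = (det g)^{-1/2} ∑ᵢⱼ ∂ᵢ ((det g)^{1/2} g^{ij} ∂ⱼ f)`. -/
def laplaceBeltrami {n : ℕ} (g : (Fin n → ℝ) → Matrix (Fin n) (Fin n) ℝ)
    (f : (Fin n → ℝ) → ℂ) (x : Fin n → ℝ) : ℂ :=
  (√(g x).det)⁻¹ • ∑ i, ∑ j,
    lineDeriv ℝ
      (fun y => (√(g y).det * (g y)⁻¹ i j) • lineDeriv ℝ f y (Pi.single j 1))
      x (Pi.single i 1)

lemma neg_pi_le_pi : -Real.pi ≤ Real.pi := by linarith [Real.pi_pos]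

instance fact_two_pi_pos : Fact (0 < 2 * Real.pi) := ⟨Real.two_pi_pos⟩

/-- The compact cylinder `[-π, π] × 𝕋¹`, where `𝕋¹ = ℝ / 2πℤ`; its points are pairs `(z, θ)`. -/
abbrev Cylinder : Type := Set.Icc (-Real.pi) Real.pi × AddCircle (2 * Real.pi)

/-- The point of the cylinder with coordinates `(z, θ)`, for `z ∈ [-π, π]`
(a real number `z` outside `[-π, π]` is first moved to the nearest end point). -/
def point (z : ℝ) (θ : AddCircle (2 * Real.pi)) : Cylinder :=
  (Set.projIcc (-Real.pi) Real.pi neg_pi_le_pi z, θ)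

/-- A function on the cylinder, read in the coordinates `x = (z, θ)` with `θ ∈ ℝ`. It is
`2π`-periodic in `θ`, and only its values at `z ∈ [-π, π]` matter. -/
def inCoord (φ : Cylinder → ℂ) : (Fin 2 → ℝ) → ℂ :=
  fun x => φ (point (x 0) (x 1 : AddCircle (2 * Real.pi)))

/-- The coefficient matrix of the warped product metric `dz² + R(z)² dθ²`
in the coordinates `(z, θ)`. -/
def warpedMetric (R : ℝ → ℝ) (z : ℝ) : Matrix (Fin 2) (Fin 2) ℝ :=
  !![1, 0; 0, R z ^ 2]

/-- The Riemannian volume measure `(det g)^{1/2} dz dθ` on the cylinder. -/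
def volumeMeasure (R : ℝ → ℝ) : Measure Cylinder :=
  (((volume : Measure ℝ).comap (Subtype.val : Set.Icc (-Real.pi) Real.pi → ℝ)).prod
    (volume : Measure (AddCircle (2 * Real.pi)))).withDensity
    (fun p => ENNReal.ofReal (√(warpedMetric R (p.1 : ℝ)).det))

/-- The Riemannian measure on the hypersurface `Σ = {z = 0}`, parametrized by `θ ∈ 𝕋¹`, for the
metric induced on it (which is `g_{θθ} dθ²` at `z = 0`). -/
def surfaceMeasure (R : ℝ → ℝ) : Measure (AddCircle (2 * Real.pi)) :=
  ENNReal.ofReal (√(warpedMetric R 0 1 1)) • volume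

/-- The restriction of a function to `Σ = {z = 0}`. -/
def trace (φ : Cylinder → ℂ) : AddCircle (2 * Real.pi) → ℂ :=
  fun θ => φ (point 0 θ)

/-- The normal derivative on `Σ = {z = 0}`. The vector field `∂_z` has length one and is
orthogonal to `∂_θ` for every warped product metric, so that it is a unit normal `ν` of `Σ`. -/
def normalTrace (φ : Cylinder → ℂ) : AddCircle (2 * Real.pi) → ℂ :=
  fun θ => deriv (fun z : ℝ => φ (point z θ)) 0

/-- `φ` is an `L²`-normalized Dirichlet eigenfunction: it is smooth up to the boundary, lies in
`L²` with norm one, solves `(-Δ_g - lam²) φ = 0` in the interior, and vanishes at `z = ± π`. -/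
structure IsNormalizedDirichletEigenfunction (R : ℝ → ℝ) (lam : ℝ) (φ : Cylinder → ℂ) :
    Prop where
  smooth : ContDiffOn ℝ ∞ (inCoord φ) {x | x 0 ∈ Set.Icc (-Real.pi) Real.pi}
  eigen : ∀ x : Fin 2 → ℝ, x 0 ∈ Set.Ioo (-Real.pi) Real.pi →
    -laplaceBeltrami (fun y => warpedMetric R (y 0)) (inCoord φ) x
      - ((lam ^ 2 : ℝ) : ℂ) * inCoord φ x = 0
  dirichlet_left : ∀ θ, φ (point (-Real.pi) θ) = 0
  dirichlet_right : ∀ θ, φ (point Real.pi θ) = 0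
  memLp : MemLp φ 2 (volumeMeasure R)
  norm_eq_one : eLpNorm φ 2 (volumeMeasure R) = 1

end WarpedCylinder

end

/-!
The eigenfunctions are products `u(z) exp(i m θ)` with `m` a large integer. For the eigenvalue
`μ = λ²` this amounts to the radial equation `(R u')' = (m² / R - μ R) u` on `[-π, π]` with
`u(± π) = 0`, where `u` even or odd reduces it to `[0, π]` with `u'(0) = 0` or `u(0) = 0`.
The effective potential `m² / R²` has a barrier `m²` at `z = 0` and a well `m² / 5` at `z = π / 2`,
so the lowest mode lives in the well, with `μ ≤ m² / 4`, and is exponentially small at the barrier.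

Existence of `μ` is a shooting argument. Written for `(u, R u')` in polar coordinates, the radial
equation becomes a scalar equation for the Prüfer angle `ϑ`, with a bounded Lipschitz right-hand
side, so that Picard-Lindelöf gives solutions on all of `[-π, π]` and Gronwall's inequality gives
continuity in `μ`. The boundary condition at `π` holds once `ϑ(π) = π`. For `μ (max R)² < m²` the
coefficient `m² / R - μ R` is positive and `ϑ(π) ≤ π / 2` (`IsPruferAngle.le_pi_div_two`). For
`μ = m² / 4` and `m` large it is at most `-κ m²` near `π / 2`, and a Riccati comparison of
`arctan (cot ϑ / A)` forces `ϑ(π) ≥ π` (`IsPruferAngle.pi_le_of_oscillation`). The intermediate value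
theorem yields `μ` between these values (`exists_angle_eq_pi`), hence also `λ → ∞` along with `m`.

With `u(0)² + (R u')(0)² = 1`, the inequality `m² / R - μ R ≥ κ m²` near `0` makes `u` at least
`η exp(ε m)` on a fixed interval inside the barrier (`IsPlanarSolution.exp_le`).
Normalizing in `L²` therefore multiplies by a factor `O(exp(-ε m)) = O(exp(-2 ε λ))`, which bounds the Cauchy data on `Σ`
(`exists_eigenfunctions`).
-/

noncomputable section

namespace WarpedCylinder

/-! ### The Prüfer angle of a planar linear system -/

/-- The angular velocity of the system `u' = p v`, `v' = q u` in the polar coordinates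
`u = r sin x`, `v = r cos x`, namely `p cos² x - q sin² x`. It is bounded in `x`, which is what makes
its solutions global. -/
def angularVelocity (p q : ℝ → ℝ) (t x : ℝ) : ℝ := p t - (p t + q t) * Real.sin x ^ 2

/-- `ϑ` is a Prüfer angle on `[-T, T]` of the system `u' = p v`, `v' = q u`, with value `θ₀` at
`0`. Derivatives are one-sided at the end points. -/
structure IsPruferAngle (p q : ℝ → ℝ) (T θ₀ : ℝ) (ϑ : ℝ → ℝ) : Prop where
  initial : ϑ 0 = θ₀
  deriv : ∀ t ∈ Set.Icc (-T) T,
    HasDerivWithinAt ϑ (angularVelocity p q t (ϑ t)) (Set.Icc (-T) T) t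

lemma abs_sin_sq_sub_sin_sq_le (x y : ℝ) :
    |Real.sin x ^ 2 - Real.sin y ^ 2| ≤ |x - y| := by
  have h : Real.sin x ^ 2 - Real.sin y ^ 2 = Real.sin (x - y) * Real.sin (x + y) := by
    rw [Real.sin_sub, Real.sin_add]
    have h1 := Real.sin_sq_add_cos_sq x
    have h2 := Real.sin_sq_add_cos_sq y
    linear_combination Real.sin y ^ 2 * h1 - Real.sin x ^ 2 * h2
  rw [h, abs_mul]
  calc |Real.sin (x - y)| * |Real.sin (x + y)| ≤ |x - y| * 1 :=
        mul_le_mul Real.abs_sin_le_abs (Real.abs_sin_le_one _) (abs_nonneg _) (abs_nonneg _)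
    _ = |x - y| := mul_one _

lemma abs_angularVelocity_sub_le (p q : ℝ → ℝ) (t x y : ℝ) :
    |angularVelocity p q t x - angularVelocity p q t y| ≤ |p t + q t| * |x - y| := by
  have h : angularVelocity p q t x - angularVelocity p q t y
      = (p t + q t) * (Real.sin y ^ 2 - Real.sin x ^ 2) := by
    unfold angularVelocity; ring
  rw [h, abs_mul, abs_sub_comm x y]
  exact mul_le_mul_of_nonneg_left (abs_sin_sq_sub_sin_sq_le y x) (abs_nonneg _)

lemma exists_isPruferAngle {p q : ℝ → ℝ} {T : ℝ} (hT : 0 ≤ T)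
    (hp : ContinuousOn p (Set.Icc (-T) T)) (hq : ContinuousOn q (Set.Icc (-T) T)) (θ₀ : ℝ) :
    ∃ ϑ, IsPruferAngle p q T θ₀ ϑ := by
  obtain ⟨P, hP⟩ := isCompact_Icc.exists_bound_of_continuousOn hp
  obtain ⟨Q, hQ⟩ := isCompact_Icc.exists_bound_of_continuousOn (hp.add hq)
  have h0 : (0 : ℝ) ∈ Set.Icc (-T) T := ⟨by linarith, hT⟩
  have hP0 : 0 ≤ P := (norm_nonneg _).trans (hP 0 h0)
  have hQ0 : 0 ≤ Q := (norm_nonneg _).trans (hQ 0 h0)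
  have key : IsPicardLindelof (angularVelocity p q) (⟨0, h0⟩ : Set.Icc (-T) T) θ₀
      (⟨(P + Q) * T, by positivity⟩) 0 (⟨P + Q, by positivity⟩) ⟨Q, hQ0⟩ :=
    { lipschitzOnWith := fun t ht => by
        refine LipschitzOnWith.of_dist_le_mul fun x _ y _ => ?_
        rw [Real.dist_eq, Real.dist_eq]
        refine (abs_angularVelocity_sub_le p q t x y).trans ?_
        exact mul_le_mul_of_nonneg_right (hQ t ht) (abs_nonneg _)
      continuousOn := fun x _ => hp.sub ((hp.add hq).mul continuousOn_const)
      norm_le := fun t ht x _ => by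
        refine (norm_sub_le _ _).trans ?_
        refine add_le_add (hP t ht) ?_
        rw [norm_mul]
        refine (mul_le_mul (hQ t ht) ?_ (norm_nonneg _) hQ0).trans_eq (mul_one Q)
        rw [Real.norm_eq_abs, abs_of_nonneg (sq_nonneg _)]
        exact Real.sin_sq_le_one x
      mul_max_le := by
        simp only [sub_zero, zero_sub, neg_neg, max_self, NNReal.coe_zero]
        exact le_rfl }
  obtain ⟨ϑ, h1, h2⟩ := key.exists_eq_forall_mem_Icc_hasDerivWithinAt₀
  exact ⟨ϑ, h1, h2⟩

namespace IsPruferAngle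

variable {p q : ℝ → ℝ} {T θ₀ : ℝ} {ϑ : ℝ → ℝ}

lemma continuousOn (h : IsPruferAngle p q T θ₀ ϑ) : ContinuousOn ϑ (Set.Icc (-T) T) :=
  fun t ht => (h.deriv t ht).continuousWithinAt

lemma hasDerivWithinAt_Ici (h : IsPruferAngle p q T θ₀ ϑ) {t : ℝ} (ht : t ∈ Set.Ico (-T) T) :
    HasDerivWithinAt ϑ (angularVelocity p q t (ϑ t)) (Set.Ici t) t :=
  (h.deriv t ⟨ht.1, ht.2.le⟩).mono_of_mem_nhdsWithin (Icc_mem_nhdsGE_of_mem ht)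

lemma hasDerivAt (h : IsPruferAngle p q T θ₀ ϑ) {t : ℝ} (ht : t ∈ Set.Ioo (-T) T) :
    HasDerivAt ϑ (angularVelocity p q t (ϑ t)) t :=
  (h.deriv t ⟨ht.1.le, ht.2.le⟩).hasDerivAt (Icc_mem_nhds ht.1 ht.2)

/-- Gronwall's inequality: continuous dependence of the Prüfer angle on the coefficient `q`. -/
lemma abs_sub_le_gronwallBound {q' ϑ' : ℝ → ℝ} {K ε : ℝ} (hK0 : 0 ≤ K)
    (h : IsPruferAngle p q T θ₀ ϑ) (h' : IsPruferAngle p q' T θ₀ ϑ')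
    (hK : ∀ t ∈ Set.Icc 0 T, |p t + q t| ≤ K) (hε : ∀ t ∈ Set.Icc 0 T, |q' t - q t| ≤ ε)
    {t : ℝ} (ht : t ∈ Set.Icc 0 T) :
    |ϑ' t - ϑ t| ≤ gronwallBound 0 K ε t := by
  have hsub : Set.Icc 0 T ⊆ Set.Icc (-T) T :=
    Set.Icc_subset_Icc (by linarith [ht.1, ht.2]) le_rfl
  have hsub' : Set.Ico 0 T ⊆ Set.Ico (-T) T :=
    Set.Ico_subset_Ico (by linarith [ht.1, ht.2]) le_rfl
  have key := dist_le_of_approx_trajectories_ODE_of_mem (v := angularVelocity p q)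
    (s := fun _ => Set.univ) (K := ⟨K, hK0⟩) (f := ϑ') (g := ϑ) (a := 0) (b := T) (δ := 0)
    (εf := ε) (εg := 0)
    (fun t ht => LipschitzOnWith.of_dist_le_mul fun x _ y _ => by
      rw [Real.dist_eq, Real.dist_eq]
      exact (abs_angularVelocity_sub_le p q t x y).trans
        (mul_le_mul_of_nonneg_right (hK t ⟨ht.1, ht.2.le⟩) (abs_nonneg _)))
    (h'.continuousOn.mono hsub) (fun t ht => h'.hasDerivWithinAt_Ici (hsub' ht))
    (fun t ht => by
      rw [Real.dist_eq]
      have e : angularVelocity p q' t (ϑ' t) - angularVelocity p q t (ϑ' t)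
          = -((q' t - q t) * Real.sin (ϑ' t) ^ 2) := by unfold angularVelocity; ring
      rw [e, abs_neg, abs_mul, abs_of_nonneg (sq_nonneg (Real.sin _))]
      have := hε t ⟨ht.1, ht.2.le⟩
      exact (mul_le_of_le_one_right (abs_nonneg _) (Real.sin_sq_le_one _)).trans this)
    (fun _ _ => Set.mem_univ _)
    (h.continuousOn.mono hsub) (fun t ht => h.hasDerivWithinAt_Ici (hsub' ht))
    (fun t _ => by rw [dist_self]) (fun _ _ => Set.mem_univ _)
    (by rw [h.initial, h'.initial, dist_self]) t ht
  rw [Real.dist_eq] at key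
  rw [sub_zero, add_zero] at key
  exact key

/-- If `θ₀` is an integer multiple of `π / 2` and the coefficients are even, then `ϑ - θ₀`
is odd. -/
lemma comp_neg (h : IsPruferAngle p q T θ₀ ϑ) (hT : 0 ≤ T)
    (hp : ContinuousOn p (Set.Icc (-T) T)) (hq : ContinuousOn q (Set.Icc (-T) T))
    (hpe : ∀ t ∈ Set.Icc (-T) T, p (-t) = p t) (hqe : ∀ t ∈ Set.Icc (-T) T, q (-t) = q t)
    (hθ₀ : Real.sin (2 * θ₀) = 0) {t : ℝ} (ht : t ∈ Set.Icc (-T) T) :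
    ϑ (-t) = 2 * θ₀ - ϑ t := by
  have hneg : ∀ s ∈ Set.Icc (-T) T, -s ∈ Set.Icc (-T) T := fun s hs =>
    ⟨by linarith [hs.2], by linarith [hs.1]⟩
  have hcos : Real.cos (2 * θ₀) ^ 2 = 1 := by
    have := Real.sin_sq_add_cos_sq (2 * θ₀)
    rw [hθ₀] at this; linarith
  have h' : IsPruferAngle p q T θ₀ (fun s => 2 * θ₀ - ϑ (-s)) := by
    refine ⟨by simp [h.initial]; ring, fun s hs => ?_⟩
    have hd := (h.deriv (-s) (hneg s hs)).scomp s (hasDerivWithinAt_neg s (Set.Icc (-T) T))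
      (fun s hs => hneg s hs)
    have hd' := hd.const_sub (2 * θ₀)
    convert! hd' using 1
    have hs2 : Real.sin (2 * θ₀ - ϑ (-s)) ^ 2 = Real.sin (ϑ (-s)) ^ 2 := by
      rw [Real.sin_sub, hθ₀]
      linear_combination Real.sin (ϑ (-s)) ^ 2 * hcos
    simp only [angularVelocity, hs2, hpe s hs, hqe s hs, smul_eq_mul]
    ring
  obtain ⟨K, hK⟩ := isCompact_Icc.exists_bound_of_continuousOn (hp.add hq)
  have hK0 : 0 ≤ K := (norm_nonneg _).trans (hK 0 ⟨by linarith, hT⟩)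
  have key : ∀ s ∈ Set.Icc 0 T, 2 * θ₀ - ϑ (-s) = ϑ s := fun s hs => by
    have := abs_sub_le_gronwallBound hK0 h h' (ε := 0)
      (fun t ht => hK t ⟨by linarith [ht.1], ht.2⟩) (fun t _ => by simp) hs
    rw [gronwallBound_ε0, zero_mul] at this
    linarith [abs_nonpos_iff.1 this]
  rcases le_total 0 t with h0 | h0
  · linarith [key t ⟨h0, ht.2⟩]
  · have := key (-t) ⟨by linarith, by linarith [ht.1]⟩
    rw [neg_neg] at this
    linarith

/-- A level at which the angular velocity is positive is crossed upwards only. -/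
lemma le_of_angularVelocity_pos (h : IsPruferAngle p q T θ₀ ϑ) {a b c : ℝ} (ha : -T ≤ a)
    (hab : a ≤ b) (hb : b ≤ T) (hc : c ≤ ϑ a)
    (hpos : ∀ t ∈ Set.Ico a b, 0 < angularVelocity p q t c) : c ≤ ϑ b := by
  refine image_le_of_deriv_right_lt_deriv_boundary' (f := fun _ => c) (f' := fun _ => 0)
    (B := ϑ) (B' := fun t => angularVelocity p q t (ϑ t)) continuousOn_const
    (fun _ _ => hasDerivWithinAt_const _ _ _) hc
    (h.continuousOn.mono (Set.Icc_subset_Icc ha hb))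
    (fun t ht => h.hasDerivWithinAt_Ici (Set.Ico_subset_Ico ha hb ht)) ?_ ⟨hab, le_rfl⟩
  intro t ht hct
  rw [← hct]
  exact hpos t ht

/-- A level at which the angular velocity is negative is crossed downwards only. -/
lemma le_of_angularVelocity_neg (h : IsPruferAngle p q T θ₀ ϑ) {a b c : ℝ} (ha : -T ≤ a)
    (hab : a ≤ b) (hb : b ≤ T) (hc : ϑ a ≤ c)
    (hneg : ∀ t ∈ Set.Ico a b, angularVelocity p q t c < 0) : ϑ b ≤ c := by
  refine image_le_of_deriv_right_lt_deriv_boundary' (f := ϑ)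
    (f' := fun t => angularVelocity p q t (ϑ t)) (B := fun _ => c) (B' := fun _ => 0)
    (h.continuousOn.mono (Set.Icc_subset_Icc ha hb))
    (fun t ht => h.hasDerivWithinAt_Ici (Set.Ico_subset_Ico ha hb ht)) hc continuousOn_const
    (fun _ _ => hasDerivWithinAt_const _ _ _) ?_ ⟨hab, le_rfl⟩
  intro t ht hct
  rw [hct]
  exact hneg t ht

lemma nonneg (h : IsPruferAngle p q T θ₀ ϑ) (hθ₀ : 0 ≤ θ₀) (hp : ∀ t ∈ Set.Icc 0 T, 0 < p t)
    {t : ℝ} (ht : t ∈ Set.Icc 0 T) : 0 ≤ ϑ t :=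
  h.le_of_angularVelocity_pos (by linarith [ht.1, ht.2]) ht.1 ht.2 (by rwa [h.initial])
    fun s hs => by simpa [angularVelocity] using hp s ⟨hs.1, hs.2.le.trans ht.2⟩

lemma pos (h : IsPruferAngle p q T θ₀ ϑ) (hθ₀ : 0 ≤ θ₀) (hp : ∀ t ∈ Set.Icc 0 T, 0 < p t)
    {t : ℝ} (ht : t ∈ Set.Ioo 0 T) : 0 < ϑ t := by
  refine (h.nonneg hθ₀ hp ⟨ht.1.le, ht.2.le⟩).lt_of_ne fun h0 => ?_
  -- a zero of `ϑ ≥ 0` would be a minimum, but the angular velocity there is `p > 0`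
  have hmin : IsLocalMin ϑ t := by
    filter_upwards [Icc_mem_nhds ht.1 ht.2] with s hs
    rw [← h0]
    exact h.nonneg hθ₀ hp hs
  have hd := h.hasDerivAt (t := t) ⟨by linarith [ht.1, ht.2], ht.2⟩
  have := hmin.hasDerivAt_eq_zero hd
  rw [← h0] at this
  have hpt := hp t ⟨ht.1.le, ht.2.le⟩
  simp [angularVelocity] at this
  linarith

/-- In a region where `q > 0` the solution does not oscillate. -/
lemma le_pi_div_two (h : IsPruferAngle p q T θ₀ ϑ) (hθ₀ : θ₀ ≤ Real.pi / 2) {b : ℝ}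
    (hb : b ∈ Set.Icc 0 T) (hq : ∀ t ∈ Set.Icc 0 b, 0 < q t) : ϑ b ≤ Real.pi / 2 :=
  h.le_of_angularVelocity_neg (by linarith [hb.1, hb.2]) hb.1 hb.2 (by rwa [h.initial])
    fun s hs => by
      have := hq s ⟨hs.1, hs.2.le⟩
      simp [angularVelocity]
      linarith

lemma pi_le_of_pi_le (h : IsPruferAngle p q T θ₀ ϑ) (hp : ∀ t ∈ Set.Icc 0 T, 0 < p t)
    {t : ℝ} (ht : t ∈ Set.Icc 0 T) (hϑ : Real.pi ≤ ϑ t) : Real.pi ≤ ϑ T :=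
  h.le_of_angularVelocity_pos (by linarith [ht.1, ht.2]) ht.2 le_rfl hϑ
    fun s hs => by simpa [angularVelocity] using hp s ⟨ht.1.trans hs.1, hs.2.le⟩

/-- Sturm comparison: where `q ≤ -p₀ A²` and `p ≥ p₀`, on an interval of length at least
`π / (p₀ A)`, the solution oscillates at least like `sin (p₀ A t)`, hence the angle passes `π`. -/
lemma pi_le_of_oscillation (h : IsPruferAngle p q T θ₀ ϑ) (hθ₀ : 0 ≤ θ₀)
    (hp : ∀ t ∈ Set.Icc 0 T, 0 < p t) {α β p₀ A : ℝ} (hα : 0 < α) (hαβ : α ≤ β) (hβ : β < T)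
    (hp₀ : 0 < p₀) (hA : 0 < A) (hpp : ∀ t ∈ Set.Icc α β, p₀ ≤ p t)
    (hqq : ∀ t ∈ Set.Icc α β, q t ≤ -(p₀ * A ^ 2)) (hlen : Real.pi ≤ p₀ * A * (β - α)) :
    Real.pi ≤ ϑ T := by
  by_contra hlt
  have hsin : ∀ t ∈ Set.Icc α β, 0 < Real.sin (ϑ t) := fun t ht => by
    have h1 : t ∈ Set.Ioo 0 T := ⟨by linarith [ht.1], by linarith [ht.2]⟩
    exact Real.sin_pos_of_pos_of_lt_pi (h.pos hθ₀ hp h1)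
      (not_le.1 fun hle => hlt (h.pi_le_of_pi_le hp ⟨h1.1.le, h1.2.le⟩ hle))
  -- the Riccati variable `y = cot ϑ` satisfies `y' = q - p y²`
  have hy : ∀ t ∈ Set.Icc α β,
      HasDerivAt (fun s => Real.arctan (Real.cos (ϑ s) / Real.sin (ϑ s) / A) + p₀ * A * s)
        (1 / (1 + (Real.cos (ϑ t) / Real.sin (ϑ t) / A) ^ 2) *
          ((q t - p t * (Real.cos (ϑ t) / Real.sin (ϑ t)) ^ 2) / A) + p₀ * A) t := fun t ht => by
    have h1 := h.hasDerivAt (t := t) ⟨by linarith [ht.1, ht.2], by linarith [ht.2]⟩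
    have hs := hsin t ht
    have hd := (((h1.cos.div h1.sin hs.ne').div_const A).arctan).add
      ((hasDerivAt_id t).const_mul (p₀ * A))
    convert! hd using 1
    have hcs : Real.cos (ϑ t) ^ 2 = 1 - Real.sin (ϑ t) ^ 2 := by
      linarith [Real.sin_sq_add_cos_sq (ϑ t)]
    rw [mul_one]
    congr 3
    unfold angularVelocity
    field_simp
    rw [hcs]
    ring
  have hanti : AntitoneOn
      (fun s => Real.arctan (Real.cos (ϑ s) / Real.sin (ϑ s) / A) + p₀ * A * s)
      (Set.Icc α β) := by
    refine antitoneOn_of_deriv_nonpos (convex_Icc α β)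
      (fun t ht => (hy t ht).continuousAt.continuousWithinAt)
      (fun t ht => (hy t (interior_subset ht)).differentiableAt.differentiableWithinAt) ?_
    intro t ht
    have ht' := interior_subset ht
    rw [(hy t ht').deriv]
    set y := Real.cos (ϑ t) / Real.sin (ϑ t)
    have h1 := hpp t ht'
    have h2 := hqq t ht'
    have h3 : q t - p t * y ^ 2 ≤ -(p₀ * A ^ 2) - p₀ * y ^ 2 := by
      nlinarith [sq_nonneg y]
    have h4 : 1 / (1 + (y / A) ^ 2) * ((-(p₀ * A ^ 2) - p₀ * y ^ 2) / A) = -(p₀ * A) := by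
      have : A ^ 2 + y ^ 2 ≠ 0 := by positivity
      field_simp
      ring
    have h5 : 1 / (1 + (y / A) ^ 2) * ((q t - p t * y ^ 2) / A) ≤
        1 / (1 + (y / A) ^ 2) * ((-(p₀ * A ^ 2) - p₀ * y ^ 2) / A) := by gcongr
    linarith
  have hfin := hanti ⟨le_rfl, hαβ⟩ ⟨hαβ, le_rfl⟩ hαβ
  simp only at hfin
  have h1 := Real.neg_pi_div_two_lt_arctan (Real.cos (ϑ β) / Real.sin (ϑ β) / A)
  have h2 := Real.arctan_lt_pi_div_two (Real.cos (ϑ α) / Real.sin (ϑ α) / A)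
  linarith

end IsPruferAngle

/-! ### Solutions of the planar system -/

/-- `(u, v)` solves `u' = p v`, `v' = q u` on `[-T, T]`, with one-sided derivatives at the end
points. -/
structure IsPlanarSolution (p q : ℝ → ℝ) (T : ℝ) (u v : ℝ → ℝ) : Prop where
  deriv_fst : ∀ t ∈ Set.Icc (-T) T, HasDerivWithinAt u (p t * v t) (Set.Icc (-T) T) t
  deriv_snd : ∀ t ∈ Set.Icc (-T) T, HasDerivWithinAt v (q t * u t) (Set.Icc (-T) T) t

/-- The solution `(r sin ϑ, r cos ϑ)` with a given Prüfer angle; the amplitude is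
`r = exp ∫ (p + q) sin ϑ cos ϑ`, and it is even because the integrand is odd. -/
lemma IsPruferAngle.exists_isPlanarSolution {p q : ℝ → ℝ} {T θ₀ : ℝ} {ϑ : ℝ → ℝ}
    (h : IsPruferAngle p q T θ₀ ϑ) (hT : 0 ≤ T)
    (hp : ContinuousOn p (Set.Icc (-T) T)) (hq : ContinuousOn q (Set.Icc (-T) T))
    (hpe : ∀ t ∈ Set.Icc (-T) T, p (-t) = p t) (hqe : ∀ t ∈ Set.Icc (-T) T, q (-t) = q t)
    (hθ₀ : Real.sin (2 * θ₀) = 0) :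
    ∃ r : ℝ → ℝ, (∀ t, 0 < r t) ∧ r 0 = 1 ∧ (∀ t ∈ Set.Icc (-T) T, r (-t) = r t) ∧
      IsPlanarSolution p q T (fun t => r t * Real.sin (ϑ t)) (fun t => r t * Real.cos (ϑ t)) := by
  have hTT : -T ≤ T := by linarith
  set f : ℝ → ℝ := fun t => (p t + q t) * (Real.sin (ϑ t) * Real.cos (ϑ t))
  have hf : ContinuousOn f (Set.Icc (-T) T) :=
    (hp.add hq).mul ((Real.continuous_sin.comp_continuousOn h.continuousOn).mul
      (Real.continuous_cos.comp_continuousOn h.continuousOn))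
  -- a continuous extension to `ℝ`, so that the primitive is differentiable at the end points too
  set F : ℝ → ℝ := Set.IccExtend hTT ((Set.Icc (-T) T).domRestrict f)
  have hF : Continuous F := (continuousOn_iff_continuous_domRestrict.1 hf).Icc_extend'
  have hFf : ∀ t ∈ Set.Icc (-T) T, F t = f t := fun t ht => by
    simp only [F, Set.IccExtend_of_mem hTT _ ht]
    rfl
  have hcos : Real.cos (2 * θ₀) ^ 2 = 1 := by
    have := Real.sin_sq_add_cos_sq (2 * θ₀)
    rw [hθ₀] at this; linarith
  have hodd : ∀ t ∈ Set.Icc (-T) T, F (-t) = -F t := fun t ht => by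
    have ht' : -t ∈ Set.Icc (-T) T := ⟨by linarith [ht.2], by linarith [ht.1]⟩
    rw [hFf t ht, hFf _ ht']
    simp only [f]
    rw [h.comp_neg hT hp hq hpe hqe hθ₀ ht, hpe t ht, hqe t ht, Real.sin_sub, Real.cos_sub, hθ₀]
    linear_combination -((p t + q t) * (Real.sin (ϑ t) * Real.cos (ϑ t))) * hcos
  have hr : ∀ t, HasDerivAt (fun t => Real.exp (∫ s in (0 : ℝ)..t, F s))
      (Real.exp (∫ s in (0 : ℝ)..t, F s) * F t) t := fun t =>
    (intervalIntegral.integral_hasDerivAt_right (hF.intervalIntegrable _ _)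
      (hF.stronglyMeasurableAtFilter _ _) hF.continuousAt).exp
  refine ⟨fun t => Real.exp (∫ s in (0 : ℝ)..t, F s), fun t => Real.exp_pos _, by simp,
    fun t ht => ?_, fun t ht => ?_, fun t ht => ?_⟩
  · have h1 : ∫ s in (0 : ℝ)..t, F (-s) = ∫ s in (0 : ℝ)..t, -F s := by
      refine intervalIntegral.integral_congr fun s hs => hodd s ?_
      exact (Set.ordConnected_Icc.uIcc_subset ⟨by linarith, hT⟩ ht) hs
    rw [intervalIntegral.integral_comp_neg, intervalIntegral.integral_neg, neg_zero,
      intervalIntegral.integral_symm] at h1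
    simp only
    rw [neg_inj.1 h1]
  · have hd := (hr t).hasDerivWithinAt.mul (h.deriv t ht).sin
    convert! hd using 1
    rw [hFf t ht]
    simp only [f, angularVelocity]
    ring
  · have hd := (hr t).hasDerivWithinAt.mul (h.deriv t ht).cos
    convert! hd using 1
    rw [hFf t ht]
    simp only [f, angularVelocity]
    have hcs : Real.cos (ϑ t) ^ 2 = 1 - Real.sin (ϑ t) ^ 2 := by
      linarith [Real.sin_sq_add_cos_sq (ϑ t)]
    linear_combination (-(p t + q t)) * Real.exp (∫ s in (0 : ℝ)..t, F s) * Real.sin (ϑ t) * hcs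

/-- Exponential growth across a barrier `[0, δ]` on which `q ≥ κ m²`. There `w = m u + v` satisfies
`w' ≥ min p₀ κ · m w`, and `u` at the end of the barrier controls `w` before it up to a factor
`m⁻¹`, which half of the exponent absorbs. -/
lemma IsPlanarSolution.exp_le {p q : ℝ → ℝ} {T : ℝ} {u v : ℝ → ℝ}
    (h : IsPlanarSolution p q T u v) {δ p₀ κ m : ℝ} (hδ : 0 < δ) (hδT : δ < T) (hp₀ : 0 < p₀)
    (hκ : 0 < κ) (hm : 1 ≤ m) (hp : ∀ t ∈ Set.Icc 0 δ, p₀ ≤ p t)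
    (hq : ∀ t ∈ Set.Icc 0 δ, κ * m ^ 2 ≤ q t) (hu : ∀ t ∈ Set.Icc 0 δ, 0 ≤ u t)
    (hv : ∀ t ∈ Set.Icc 0 δ, 0 ≤ v t) (hw : 1 ≤ m * u 0 + v 0) {t : ℝ}
    (ht : t ∈ Set.Icc (2 * δ / 3) δ) :
    min 1 (p₀ * δ / 3) * (min p₀ κ * δ / 6) * Real.exp (min p₀ κ * δ / 6 * m) ≤ u t := by
  set σ := min p₀ κ
  have hσ : 0 < σ := lt_min hp₀ hκ
  set η := min 1 (p₀ * δ / 3)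
  have hη : 0 < η := lt_min one_pos (by positivity)
  have hm0 : 0 < m := by linarith
  have hdu : ∀ s ∈ Set.Icc 0 δ, HasDerivAt u (p s * v s) s := fun s hs =>
    (h.deriv_fst s ⟨by linarith [hs.1], by linarith [hs.2]⟩).hasDerivAt
      (Icc_mem_nhds (by linarith [hs.1]) (by linarith [hs.2]))
  have hdv : ∀ s ∈ Set.Icc 0 δ, HasDerivAt v (q s * u s) s := fun s hs =>
    (h.deriv_snd s ⟨by linarith [hs.1], by linarith [hs.2]⟩).hasDerivAt
      (Icc_mem_nhds (by linarith [hs.1]) (by linarith [hs.2]))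
  have mono : ∀ (f f' : ℝ → ℝ) (a b : ℝ), a ≤ b →
      (∀ s ∈ Set.Icc a b, HasDerivAt f (f' s) s) → (∀ s ∈ Set.Icc a b, 0 ≤ f' s) →
      f a ≤ f b := by
    intro f f' a b hab hf hf'
    refine monotoneOn_of_deriv_nonneg (convex_Icc a b)
      (fun s hs => (hf s hs).continuousAt.continuousWithinAt)
      (fun s hs => (hf s (interior_subset hs)).differentiableAt.differentiableWithinAt)
      (fun s hs => ?_) ⟨le_rfl, hab⟩ ⟨hab, le_rfl⟩ hab
    rw [(hf s (interior_subset hs)).deriv]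
    exact hf' s (interior_subset hs)
  have hδ3 : (0 : ℝ) ≤ δ / 3 := by positivity
  have hzm : δ / 3 ∈ Set.Icc 0 δ := ⟨hδ3, by linarith⟩
  -- growth of `m u + v` up to `δ / 3`
  have h1 : Real.exp (σ * m * (δ / 3)) ≤ m * u (δ / 3) + v (δ / 3) := by
    have := mono (fun s => Real.exp (-(σ * m) * s) * (m * u s + v s))
      (fun s => Real.exp (-(σ * m) * s) * (-(σ * m)) * (m * u s + v s) +
        Real.exp (-(σ * m) * s) * (m * (p s * v s) + q s * u s)) 0 (δ / 3)
      hδ3 (fun s hs => by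
        have hs' : s ∈ Set.Icc 0 δ := ⟨hs.1, by linarith [hs.2]⟩
        have he : HasDerivAt (fun s => Real.exp (-(σ * m) * s))
            (Real.exp (-(σ * m) * s) * (-(σ * m))) s := by
          simpa using ((hasDerivAt_id s).const_mul (-(σ * m))).exp
        exact he.mul (((hdu s hs').const_mul m).add (hdv s hs')))
      (fun s hs => by
        have hs' : s ∈ Set.Icc 0 δ := ⟨hs.1, by linarith [hs.2]⟩
        have h2 : σ * m * v s ≤ m * (p s * v s) := by
          have : σ * (m * v s) ≤ p s * (m * v s) := mul_le_mul_of_nonneg_right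
            ((min_le_left _ _).trans (hp s hs')) (mul_nonneg hm0.le (hv s hs'))
          linarith
        have h3 : σ * m * (m * u s) ≤ q s * u s := by
          have h4 : σ * m ^ 2 ≤ q s :=
            (mul_le_mul_of_nonneg_right (min_le_right _ _) (sq_nonneg m)).trans (hq s hs')
          have := mul_le_mul_of_nonneg_right h4 (hu s hs')
          linarith
        have h5 := mul_nonneg (Real.exp_pos (-(σ * m) * s)).le
          (sub_nonneg.2 (add_le_add h2 h3))
        linarith)
    simp only [mul_zero, Real.exp_zero, one_mul] at this
    have h6 : 1 ≤ Real.exp (-(σ * m) * (δ / 3)) * (m * u (δ / 3) + v (δ / 3)) := hw.trans this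
    have h7 : Real.exp (-(σ * m) * (δ / 3)) = (Real.exp (σ * m * (δ / 3)))⁻¹ := by
      rw [← Real.exp_neg]; ring_nf
    rw [h7, inv_mul_eq_div, one_le_div (Real.exp_pos _)] at h6
    exact h6
  have hvm : ∀ s ∈ Set.Icc (δ / 3) δ, v (δ / 3) ≤ v s := fun s hs =>
    mono v (fun s => q s * u s) (δ / 3) s hs.1
      (fun x hx => hdv x ⟨hδ3.trans hx.1, hx.2.trans hs.2⟩)
      (fun x hx => by
        have hx' : x ∈ Set.Icc 0 δ := ⟨hδ3.trans hx.1, hx.2.trans hs.2⟩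
        exact mul_nonneg ((by positivity : 0 ≤ κ * m ^ 2).trans (hq x hx')) (hu x hx'))
  -- mean value inequality for `u` on `[δ / 3, t]`
  have h2 : u (δ / 3) + p₀ * δ / 3 * v (δ / 3) ≤ u t := by
    have := mono (fun s => u s - p₀ * v (δ / 3) * s) (fun s => p s * v s - p₀ * v (δ / 3))
      (δ / 3) t (by linarith [ht.1])
      (fun s hs => by
        have hs' : s ∈ Set.Icc 0 δ := ⟨hδ3.trans hs.1, hs.2.trans ht.2⟩
        convert! (hdu s hs').sub ((hasDerivAt_id s).const_mul (p₀ * v (δ / 3))) using 1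
        rw [mul_one])
      (fun s hs => by
        have hs' : s ∈ Set.Icc 0 δ := ⟨hδ3.trans hs.1, hs.2.trans ht.2⟩
        have := hvm s ⟨hs.1, hs.2.trans ht.2⟩
        have := mul_le_mul (hp s hs') this (hv _ hzm) (hp₀.le.trans (hp s hs'))
        linarith)
    have h3 : p₀ * v (δ / 3) * (δ / 3) ≤ p₀ * v (δ / 3) * (t - δ / 3) :=
      mul_le_mul_of_nonneg_left (by linarith [ht.1]) (mul_nonneg hp₀.le (hv _ hzm))
    linarith
  have h3 : η * Real.exp (σ * m * (δ / 3)) ≤ m * u t := by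
    have h4 : η * (m * u (δ / 3)) ≤ m * u (δ / 3) :=
      mul_le_of_le_one_left (mul_nonneg hm0.le (hu _ hzm)) (min_le_left _ _)
    have h5 : η * v (δ / 3) ≤ m * (p₀ * δ / 3 * v (δ / 3)) :=
      (mul_le_mul_of_nonneg_right (min_le_right _ _) (hv _ hzm)).trans
        (le_mul_of_one_le_left (mul_nonneg (by positivity) (hv _ hzm)) hm)
    have h6 := mul_le_mul_of_nonneg_left h1 hη.le
    have h7 := mul_le_mul_of_nonneg_left h2 hm0.le
    linarith
  -- one half of the exponent absorbs the factor `m`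
  have h4 : σ * δ / 6 * m * Real.exp (σ * δ / 6 * m) ≤ Real.exp (σ * m * (δ / 3)) := by
    have : Real.exp (σ * m * (δ / 3)) = Real.exp (σ * δ / 6 * m) * Real.exp (σ * δ / 6 * m) := by
      rw [← Real.exp_add]; ring_nf
    rw [this]
    refine mul_le_mul_of_nonneg_right ?_ (Real.exp_pos _).le
    linarith [Real.add_one_le_exp (σ * δ / 6 * m)]
  have h5 := mul_le_mul_of_nonneg_left h4 hη.le
  refine le_of_mul_le_mul_left ?_ hm0
  linarith

lemma IsPlanarSolution.contDiffOn_fst {p q : ℝ → ℝ} {T : ℝ} {u v : ℝ → ℝ}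
    (h : IsPlanarSolution p q T u v) (hp : ContDiffOn ℝ ∞ p (Set.Icc (-T) T))
    (hq : ContDiffOn ℝ ∞ q (Set.Icc (-T) T)) : ContDiffOn ℝ ∞ u (Set.Icc (-T) T) := by
  have key : ContDiffOn ℝ ((⊤ : ℕ∞) : ℕ∞ω) (fun t => (u t, v t)) (Set.Icc (-T) T) := by
    refine ODE.contDiffOn_enat_Icc_of_hasDerivWithinAt (u := Set.univ)
      (f := fun t (w : ℝ × ℝ) => (p t * w.2, q t * w.1)) ?_
      (fun t ht => (h.deriv_fst t ht).prodMk (h.deriv_snd t ht)) (fun _ _ => Set.mem_univ _)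
    have hfst : Set.MapsTo Prod.fst (Set.Icc (-T) T ×ˢ (Set.univ : Set (ℝ × ℝ)))
      (Set.Icc (-T) T) := fun x hx => hx.1
    have hp' := hp.comp contDiff_fst.contDiffOn hfst
    have hq' := hq.comp contDiff_fst.contDiffOn hfst
    exact (hp'.mul contDiff_snd.snd.contDiffOn).prodMk (hq'.mul contDiff_snd.fst.contDiffOn)
  exact key.fst

/-! ### Radial modes concentrated away from the equator -/

lemma exists_forall_mem_Icc_lt {f : ℝ → ℝ} {T z₀ : ℝ} (hf : ContinuousOn f (Set.Icc (-T) T))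
    (hz₀ : z₀ ∈ Set.Ioo (-T) T) {a b : ℝ} (ha : a < f z₀) (hb : f z₀ < b) :
    ∃ d, 0 < d ∧ d ≤ 1 ∧ ∀ z ∈ Set.Icc (z₀ - d) (z₀ + d), a < f z ∧ f z < b := by
  have hc : ContinuousAt f z₀ := hf.continuousAt (Icc_mem_nhds hz₀.1 hz₀.2)
  obtain ⟨ε, hε, h⟩ := Metric.eventually_nhds_iff.1
    ((hc.eventually_const_lt ha).and (hc.eventually_lt_const hb))
  refine ⟨min (ε / 2) 1, by positivity, min_le_right _ _, fun z hz => h ?_⟩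
  rw [Real.dist_eq]
  have h1 : |z - z₀| ≤ min (ε / 2) 1 := abs_le.2 ⟨by linarith [hz.1], by linarith [hz.2]⟩
  linarith [min_le_left (ε / 2) 1]

/-- The coefficient `m² / R - μ R` of the radial equation `(R u')' = (m² / R - μ R) u` of the
modes `u(z) exp(i m θ)` with eigenvalue `μ`. -/
def radialCoeff (R : ℝ → ℝ) (m μ z : ℝ) : ℝ := m ^ 2 * (R z)⁻¹ - μ * R z

lemma radialCoeff_eq {R : ℝ → ℝ} {z : ℝ} (h : 0 < R z) (m μ : ℝ) :
    radialCoeff R m μ z * R z = m ^ 2 - μ * R z ^ 2 := by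
  unfold radialCoeff; field_simp

lemma continuousOn_radialCoeff {R : ℝ → ℝ} {s : Set ℝ} (hR : ContinuousOn R s)
    (hpos : ∀ z ∈ s, 0 < R z) (m μ : ℝ) : ContinuousOn (radialCoeff R m μ) s :=
  (continuousOn_const.mul (hR.inv₀ fun z hz => (hpos z hz).ne')).sub (continuousOn_const.mul hR)

/-- Shooting in the spectral parameter: a parameter `μ` for which the Prüfer angle at `T` is
exactly `π`, found between `0`, where the solution does not oscillate, and any `μ₁` at which the
angle has passed `π`. Non-oscillation also bounds `μ` from below. -/
lemma exists_angle_eq_pi {R : ℝ → ℝ} {T b m μ₁ θ₀ : ℝ} (hT : 0 ≤ T)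
    (hR : ContinuousOn R (Set.Icc (-T) T)) (hpos : ∀ z ∈ Set.Icc (-T) T, 0 < R z)
    (hb : ∀ z ∈ Set.Icc (-T) T, R z ≤ b) (hm : 0 < m) (hμ₁ : 0 ≤ μ₁) (hθ₀ : θ₀ ≤ Real.pi / 2)
    (hosc : ∀ ϑ, IsPruferAngle (fun z => (R z)⁻¹) (radialCoeff R m μ₁) T θ₀ ϑ → Real.pi ≤ ϑ T) :
    ∃ μ ϑ, IsPruferAngle (fun z => (R z)⁻¹) (radialCoeff R m μ) T θ₀ ϑ ∧ ϑ T = Real.pi ∧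
      m ^ 2 ≤ μ * b ^ 2 ∧ μ ≤ μ₁ := by
  have hsub : Set.Icc 0 T ⊆ Set.Icc (-T) T := Set.Icc_subset_Icc (by linarith) le_rfl
  have hTT : T ∈ Set.Icc 0 T := ⟨hT, le_rfl⟩
  have hp : ContinuousOn (fun z => (R z)⁻¹) (Set.Icc (-T) T) :=
    hR.inv₀ fun z hz => (hpos z hz).ne'
  have hb0 : 0 ≤ b := (hpos T (hsub hTT)).le.trans (hb T (hsub hTT))
  choose ϑ hϑ using fun μ : ℝ =>
    exists_isPruferAngle hT hp (continuousOn_radialCoeff hR hpos m μ) θ₀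
  have hcont : Continuous fun μ => ϑ μ T := by
    rw [continuous_iff_continuousAt]
    intro μ
    obtain ⟨K, hK⟩ := isCompact_Icc.exists_bound_of_continuousOn
      (hp.add (continuousOn_radialCoeff hR hpos m μ))
    have hK0 : 0 ≤ K := (norm_nonneg _).trans (hK T (hsub hTT))
    have hbd : ∀ μ', |ϑ μ' T - ϑ μ T| ≤ gronwallBound 0 K (|μ' - μ| * b) T := fun μ' =>
      (hϑ μ).abs_sub_le_gronwallBound hK0 (hϑ μ') (fun t ht => hK t (hsub ht))
        (fun t ht => by
          have e : radialCoeff R m μ' t - radialCoeff R m μ t = -((μ' - μ) * R t) := by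
            unfold radialCoeff; ring
          rw [e, abs_neg, abs_mul, abs_of_pos (hpos t (hsub ht))]
          exact mul_le_mul_of_nonneg_left (hb t (hsub ht)) (abs_nonneg _)) hTT
    have hlim : Tendsto (fun μ' => gronwallBound 0 K (|μ' - μ| * b) T) (𝓝 μ) (𝓝 0) := by
      have hc : Continuous fun μ' => gronwallBound 0 K (|μ' - μ| * b) T :=
        (gronwallBound_continuous_ε 0 K T).comp (by fun_prop)
      have := hc.tendsto μ
      simpa [gronwallBound_ε0] using this
    exact tendsto_iff_dist_tendsto_zero.2
      (squeeze_zero (fun _ => dist_nonneg) (fun μ' => by rw [Real.dist_eq]; exact hbd μ') hlim)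
  have hsmall : ∀ μ, μ * b ^ 2 < m ^ 2 → 0 ≤ μ → ϑ μ T < Real.pi := fun μ hμ hμ0 => by
    have := (hϑ μ).le_pi_div_two hθ₀ hTT fun t ht => by
      have h1 := hpos t (hsub ht)
      have h2 : R t ^ 2 ≤ b ^ 2 := pow_le_pow_left₀ h1.le (hb t (hsub ht)) 2
      refine pos_of_mul_pos_left ?_ h1.le
      rw [radialCoeff_eq h1]
      linarith [mul_le_mul_of_nonneg_left h2 hμ0]
    linarith [Real.pi_pos]
  obtain ⟨μ, hμ, h⟩ := intermediate_value_Icc hμ₁ hcont.continuousOn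
    ⟨(hsmall 0 (by rw [zero_mul]; positivity) le_rfl).le, hosc _ (hϑ μ₁)⟩
  exact ⟨μ, ϑ μ, hϑ μ, h, not_lt.1 fun hlt => (hsmall μ hlt hμ.1).ne h, hμ.2⟩

/-- Dirichlet modes `u(z) exp(i m θ)` for all large `m`, with eigenvalue `μ ≤ m² / 4`. The effective
potential `m² / R²` dips to `m² / 5` at `z = π / 2`, which yields the upper bound on `μ`, but is at
least `m² / 2` in a neighbourhood of `z = 0`, across which `u` grows exponentially. The angle
`θ₀ = π / 2` gives the modes even in `z`, `θ₀ = 0` the odd ones. -/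
theorem exists_radial_modes {R : ℝ → ℝ}
    (hR : ContinuousOn R (Set.Icc (-Real.pi) Real.pi))
    (hpos : ∀ z ∈ Set.Icc (-Real.pi) Real.pi, 0 < R z)
    (heven : ∀ z ∈ Set.Icc (-Real.pi) Real.pi, R (-z) = R z)
    (hR_zero : R 0 = 1) (hR_half : R (Real.pi / 2) = √5)
    {θ₀ : ℝ} (hθ₀ : θ₀ = 0 ∨ θ₀ = Real.pi / 2) :
    ∃ b η ε δ : ℝ, 0 < b ∧ 0 < η ∧ 0 < ε ∧ 0 < δ ∧ δ ≤ 1 ∧ ∃ m₀ : ℕ, ∀ m : ℕ, m₀ ≤ m →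
      ∃ μ : ℝ, (m : ℝ) ^ 2 ≤ μ * b ^ 2 ∧ μ ≤ (m : ℝ) ^ 2 / 4 ∧ ∃ u v : ℝ → ℝ,
        IsPlanarSolution (fun z => (R z)⁻¹) (radialCoeff R m μ) Real.pi u v ∧
        u 0 = Real.sin θ₀ ∧ v 0 = Real.cos θ₀ ∧ u Real.pi = 0 ∧
        (∀ z ∈ Set.Icc (-Real.pi) Real.pi, u (-z) = -Real.cos (2 * θ₀) * u z) ∧
        ∀ z ∈ Set.Icc (2 * δ / 3) δ, η * Real.exp (ε * m) ≤ u z := by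
  have hπ := Real.pi_gt_three
  have hsub : Set.Icc 0 Real.pi ⊆ Set.Icc (-Real.pi) Real.pi :=
    Set.Icc_subset_Icc (by linarith) le_rfl
  have h0mem : (0 : ℝ) ∈ Set.Icc (-Real.pi) Real.pi := ⟨by linarith, by linarith⟩
  -- two-sided bounds for `R`
  obtain ⟨b, hb'⟩ := isCompact_Icc.exists_bound_of_continuousOn hR
  have hb : ∀ z ∈ Set.Icc (-Real.pi) Real.pi, R z ≤ b := fun z hz =>
    (le_abs_self _).trans (hb' z hz)
  obtain ⟨z₁, hz₁, hmin⟩ := isCompact_Icc.exists_isMinOn ⟨0, h0mem⟩ hR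
  set a := R z₁
  have ha : ∀ z ∈ Set.Icc (-Real.pi) Real.pi, a ≤ R z := fun z hz => hmin hz
  have ha0 : 0 < a := hpos z₁ hz₁
  have hb0 : 0 < b := ha0.trans_le (hb z₁ hz₁)
  have hp : ContinuousOn (fun z => (R z)⁻¹) (Set.Icc (-Real.pi) Real.pi) :=
    hR.inv₀ fun z hz => (hpos z hz).ne'
  have hppos : ∀ z ∈ Set.Icc 0 Real.pi, 0 < (R z)⁻¹ := fun z hz => inv_pos.2 (hpos z (hsub hz))
  have hpb : ∀ z ∈ Set.Icc (-Real.pi) Real.pi, b⁻¹ ≤ (R z)⁻¹ := fun z hz =>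
    inv_anti₀ (hpos z hz) (hb z hz)
  -- the barrier around `0` and the well around `π / 2`
  obtain ⟨δ, hδ, hδ1, hbar⟩ := exists_forall_mem_Icc_lt (hR.pow 2) (z₀ := 0)
    ⟨by linarith, by linarith⟩ (a := 0) (b := 2) (by simp [hR_zero]) (by simp [hR_zero])
  obtain ⟨d, hd, hd1, hwell⟩ := exists_forall_mem_Icc_lt (hR.pow 2) (z₀ := Real.pi / 2)
    ⟨by linarith, by linarith⟩ (a := 9 / 2) (b := 6)
    (by simp [hR_half]; norm_num) (by simp [hR_half]; norm_num)
  have hθ0 : 0 ≤ θ₀ := by rcases hθ₀ with h | h <;> rw [h]; positivity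
  have hθ1 : θ₀ ≤ Real.pi / 2 := by rcases hθ₀ with h | h <;> rw [h]; positivity
  have hθ2 : Real.sin (2 * θ₀) = 0 := by
    rcases hθ₀ with h | h <;> rw [h]
    · simp
    · rw [mul_div_cancel₀ _ two_ne_zero, Real.sin_pi]
  set s := √(a * b) / 6
  have hs0 : 0 < s := by positivity
  have hs2 : b⁻¹ * s ^ 2 = a / 36 := by
    have : s ^ 2 = a * b / 36 := by
      simp only [s, div_pow, Real.sq_sqrt (mul_pos ha0 hb0).le]; norm_num
    rw [this]; field_simp
  obtain ⟨m₁, hm₁⟩ := exists_nat_ge (Real.pi / (b⁻¹ * s * (2 * d)))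
  refine ⟨b, min 1 (b⁻¹ * δ / 3) * (min b⁻¹ (a / 4) * δ / 6), min b⁻¹ (a / 4) * δ / 6, δ, hb0,
    by positivity, by positivity, hδ, hδ1, max 1 m₁, fun m hm => ?_⟩
  have hm1 : (1 : ℝ) ≤ m := by exact_mod_cast (le_max_left _ _).trans hm
  have hmm : (m₁ : ℝ) ≤ m := by exact_mod_cast (le_max_right _ _).trans hm
  have hm0 : (0 : ℝ) < m := by linarith
  obtain ⟨μ, ϑ, hϑ, hϑπ, hμb, hμ⟩ := exists_angle_eq_pi (T := Real.pi) (μ₁ := (m : ℝ) ^ 2 / 4)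
    Real.pi_pos.le hR hpos hb hm0 (by positivity) hθ1 fun ϑ hϑ => by
      refine hϑ.pi_le_of_oscillation hθ0 hppos (α := Real.pi / 2 - d) (β := Real.pi / 2 + d)
        (p₀ := b⁻¹) (A := m * s) (by linarith) (by linarith) (by linarith) (by positivity)
        (by positivity) (fun z hz => hpb z ⟨by linarith [hz.1], by linarith [hz.2]⟩)
        (fun z hz => ?_) ?_
      · have hzm : z ∈ Set.Icc (-Real.pi) Real.pi := ⟨by linarith [hz.1], by linarith [hz.2]⟩
        have h1 := hpos z hzm
        have h2 := (hwell z hz).1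
        rw [mul_pow, mul_left_comm, hs2]
        refine le_of_mul_le_mul_right ?_ h1
        rw [radialCoeff_eq h1]
        -- `R² > 9 / 2` gives `m² - m² R² / 4 ≤ - m² R² / 36`
        have h3 : a * R z ≤ R z ^ 2 := by
          rw [sq]; exact mul_le_mul_of_nonneg_right (ha z hzm) h1.le
        simp only [Pi.pow_apply] at h2
        nlinarith [mul_le_mul_of_nonneg_left h3 (sq_nonneg (m : ℝ)),
          mul_le_mul_of_nonneg_left h2.le (sq_nonneg (m : ℝ))]
      · rw [div_le_iff₀ (by positivity)] at hm₁
        have := mul_le_mul_of_nonneg_right hmm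
          (by positivity : 0 ≤ b⁻¹ * s * (2 * d))
        linarith
  have hμ0 : 0 ≤ μ := by
    by_contra hlt
    have : μ * b ^ 2 ≤ 0 := mul_nonpos_of_nonpos_of_nonneg (not_le.1 hlt).le (sq_nonneg b)
    have : 0 < (m : ℝ) ^ 2 := by positivity
    linarith
  obtain ⟨r, hr, hr0, hre, hsol⟩ := hϑ.exists_isPlanarSolution Real.pi_pos.le hp
    (continuousOn_radialCoeff hR hpos m μ) (fun z hz => by rw [heven z hz])
    (fun z hz => by rw [radialCoeff, radialCoeff, heven z hz]) hθ2
  have hκ : ∀ z ∈ Set.Icc 0 δ, a / 4 * (m : ℝ) ^ 2 ≤ radialCoeff R m μ z := fun z hz => by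
    have hzm : z ∈ Set.Icc (-Real.pi) Real.pi := ⟨by linarith [hz.1], by linarith [hz.2]⟩
    have h1 := hpos z hzm
    have h2 := (hbar z ⟨by linarith [hz.1], by linarith [hz.2]⟩).2
    simp only [Pi.pow_apply] at h2
    refine le_of_mul_le_mul_right ?_ h1
    rw [radialCoeff_eq h1]
    -- `R² < 2` gives `m² - μ R² ≥ m² / 2 ≥ m² R² / 4`
    have h3 : a * R z ≤ R z ^ 2 := by
      rw [sq]; exact mul_le_mul_of_nonneg_right (ha z hzm) h1.le
    nlinarith [mul_le_mul_of_nonneg_left h3 (sq_nonneg (m : ℝ)),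
      mul_le_mul_of_nonneg_left h2.le (sq_nonneg (m : ℝ)),
      mul_le_mul_of_nonneg_right hμ (sq_nonneg (R z))]
  have hκ0 : ∀ z ∈ Set.Icc 0 δ, 0 < radialCoeff R m μ z := fun z hz =>
    (by positivity : 0 < a / 4 * (m : ℝ) ^ 2).trans_le (hκ z hz)
  have hϑ0 : ∀ z ∈ Set.Icc 0 δ, 0 ≤ ϑ z := fun z hz =>
    hϑ.nonneg hθ0 hppos ⟨hz.1, by linarith [hz.2]⟩
  have hϑ1 : ∀ z ∈ Set.Icc 0 δ, ϑ z ≤ Real.pi / 2 := fun z hz =>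
    hϑ.le_pi_div_two hθ1 ⟨hz.1, by linarith [hz.2]⟩ fun t ht => hκ0 t ⟨ht.1, ht.2.trans hz.2⟩
  refine ⟨μ, hμb, hμ, _, _, hsol, by simp [hr0, hϑ.initial], by simp [hr0, hϑ.initial],
    by simp [hϑπ], fun z hz => ?_, fun z hz => ?_⟩
  · rw [hre z hz, hϑ.comp_neg Real.pi_pos.le hp (continuousOn_radialCoeff hR hpos m μ)
      (fun z hz => by rw [heven z hz]) (fun z hz => by rw [radialCoeff, radialCoeff, heven z hz])
      hθ2 hz, Real.sin_sub, hθ2]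
    ring
  · refine hsol.exp_le hδ (by linarith) (inv_pos.2 hb0) (by positivity) hm1
      (fun t ht => hpb t ⟨by linarith [ht.1], by linarith [ht.2]⟩) hκ
      (fun t ht => mul_nonneg (hr t).le
        (Real.sin_nonneg_of_nonneg_of_le_pi (hϑ0 t ht) (by linarith [hϑ1 t ht])))
      (fun t ht => mul_nonneg (hr t).le
        (Real.cos_nonneg_of_neg_pi_div_two_le_of_le (by linarith [hϑ0 t ht]) (hϑ1 t ht))) ?_ hz
    rw [hr0, hϑ.initial]
    rcases hθ₀ with h | h <;> simp [h, hm1]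

/-! ### Product modes on the cylinder -/

/-- The function `u(z) exp(i m θ)` on the cylinder. -/
def productMode (u : ℝ → ℝ) (m : ℤ) : Cylinder → ℂ := fun x => (u x.1 : ℂ) * fourier m x.2

lemma productMode_point (u : ℝ → ℝ) (m : ℤ) {z : ℝ} (hz : z ∈ Set.Icc (-Real.pi) Real.pi)
    (θ : AddCircle (2 * Real.pi)) : productMode u m (point z θ) = (u z : ℂ) * fourier m θ := by
  simp only [productMode, point, Set.projIcc_of_mem neg_pi_le_pi hz]

lemma inCoord_productMode (u : ℝ → ℝ) (m : ℤ) {x : Fin 2 → ℝ}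
    (hx : x 0 ∈ Set.Icc (-Real.pi) Real.pi) :
    inCoord (productMode u m) x = (u (x 0) : ℂ) * Complex.exp (Complex.I * m * (x 1 : ℝ)) := by
  rw [inCoord, productMode_point u m hx, fourier_coe_apply]
  congr 2
  have : (Real.pi : ℂ) ≠ 0 := by exact_mod_cast Real.pi_ne_zero
  push_cast
  field_simp

lemma contDiffOn_inCoord_productMode {u : ℝ → ℝ}
    (hu : ContDiffOn ℝ ∞ u (Set.Icc (-Real.pi) Real.pi)) (m : ℤ) :
    ContDiffOn ℝ ∞ (inCoord (productMode u m)) {x | x 0 ∈ Set.Icc (-Real.pi) Real.pi} := by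
  have h0 : ContDiffOn ℝ ∞ (fun x : Fin 2 → ℝ => u (x 0))
      {x | x 0 ∈ Set.Icc (-Real.pi) Real.pi} :=
    hu.comp (contDiff_apply ℝ ℝ (0 : Fin 2)).contDiffOn fun x hx => hx
  have h1 : ContDiff ℝ ∞ fun x : Fin 2 → ℝ => Complex.exp (Complex.I * m * (x 1 : ℝ)) :=
    (contDiff_const.mul (Complex.ofRealCLM.contDiff.comp (contDiff_apply ℝ ℝ (1 : Fin 2)))).cexp
  exact ((Complex.ofRealCLM.contDiff.comp_contDiffOn h0).mul h1.contDiffOn).congr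
    fun x hx => inCoord_productMode u m hx

lemma lineDeriv_product_fst {F : (Fin 2 → ℝ) → ℂ} {f g : ℝ → ℂ} {s : Set ℝ} (hs : IsOpen s)
    (hF : ∀ y : Fin 2 → ℝ, y 0 ∈ s → F y = f (y 0) * g (y 1)) {x : Fin 2 → ℝ} (hx : x 0 ∈ s)
    {f' : ℂ} (hf : HasDerivAt f f' (x 0)) :
    lineDeriv ℝ F x (Pi.single 0 1) = f' * g (x 1) := by
  have h : HasDerivAt (fun t : ℝ => f (x 0 + t) * g (x 1)) (f' * g (x 1)) 0 :=
    (HasDerivAt.comp_const_add (x 0) 0 (by simpa using hf)).mul_const _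
  refine (h.congr_of_eventuallyEq ?_).deriv
  have hc : ContinuousAt (fun t : ℝ => x 0 + t) 0 := by fun_prop
  filter_upwards [hc.eventually_mem (hs.mem_nhds (by simpa using hx))] with t ht
  rw [hF _ (by simpa using ht)]
  simp

lemma lineDeriv_product_snd {F : (Fin 2 → ℝ) → ℂ} {f g : ℝ → ℂ} {s : Set ℝ}
    (hF : ∀ y : Fin 2 → ℝ, y 0 ∈ s → F y = f (y 0) * g (y 1)) {x : Fin 2 → ℝ} (hx : x 0 ∈ s)
    {g' : ℂ} (hg : HasDerivAt g g' (x 1)) :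
    lineDeriv ℝ F x (Pi.single 1 1) = f (x 0) * g' := by
  have h : HasDerivAt (fun t : ℝ => f (x 0) * g (x 1 + t)) (f (x 0) * g') 0 :=
    (HasDerivAt.comp_const_add (x 1) 0 (by simpa using hg)).const_mul _
  refine (h.congr_of_eventuallyEq (Eventually.of_forall fun t => ?_)).deriv
  simp only
  rw [hF _ (by simpa using hx)]
  simp

lemma sqrt_det_warpedMetric {R : ℝ → ℝ} {z : ℝ} (h : 0 < R z) :
    √(warpedMetric R z).det = R z := by
  simp [warpedMetric, Real.sqrt_sq h.le]

lemma inv_warpedMetric {R : ℝ → ℝ} {z : ℝ} (h : 0 < R z) :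
    (warpedMetric R z)⁻¹ = !![1, 0; 0, (R z ^ 2)⁻¹] := by
  refine Matrix.inv_eq_right_inv ?_
  ext i j
  fin_cases i <;> fin_cases j <;> simp [warpedMetric, Matrix.mul_apply, h.ne']

/-- Separation of variables. -/
lemma laplaceBeltrami_productMode {R u v : ℝ → ℝ} {m : ℤ} {μ : ℝ}
    (hpos : ∀ z ∈ Set.Icc (-Real.pi) Real.pi, 0 < R z)
    (h : IsPlanarSolution (fun z => (R z)⁻¹) (radialCoeff R m μ) Real.pi u v)
    {x : Fin 2 → ℝ} (hx : x 0 ∈ Set.Ioo (-Real.pi) Real.pi) :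
    laplaceBeltrami (fun y => warpedMetric R (y 0)) (inCoord (productMode u m)) x =
      -(μ : ℂ) * inCoord (productMode u m) x := by
  have hu : ∀ z ∈ Set.Ioo (-Real.pi) Real.pi,
      HasDerivAt (fun z => (u z : ℂ)) (((R z)⁻¹ * v z : ℝ) : ℂ) z := fun z hz =>
    ((h.deriv_fst z ⟨hz.1.le, hz.2.le⟩).hasDerivAt (Icc_mem_nhds hz.1 hz.2)).ofReal_comp
  have hv : ∀ z ∈ Set.Ioo (-Real.pi) Real.pi,
      HasDerivAt (fun z => (v z : ℂ)) ((radialCoeff R m μ z * u z : ℝ) : ℂ) z := fun z hz =>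
    ((h.deriv_snd z ⟨hz.1.le, hz.2.le⟩).hasDerivAt (Icc_mem_nhds hz.1 hz.2)).ofReal_comp
  have hRz : ∀ z ∈ Set.Ioo (-Real.pi) Real.pi, 0 < R z := fun z hz =>
    hpos z ⟨hz.1.le, hz.2.le⟩
  set e : ℝ → ℂ := fun t => Complex.exp (Complex.I * m * t)
  have he : ∀ t, HasDerivAt e (Complex.I * m * e t) t := fun t => by
    have := ((Complex.ofRealCLM.hasDerivAt (x := t)).const_mul (Complex.I * (m : ℂ))).cexp
    convert! this using 1
    simp [e, mul_comm]
  have hφ : ∀ y : Fin 2 → ℝ, y 0 ∈ Set.Ioo (-Real.pi) Real.pi →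
      inCoord (productMode u m) y = (u (y 0) : ℂ) * e (y 1) := fun y hy =>
    inCoord_productMode u m ⟨hy.1.le, hy.2.le⟩
  have hd0 : ∀ y : Fin 2 → ℝ, y 0 ∈ Set.Ioo (-Real.pi) Real.pi →
      lineDeriv ℝ (inCoord (productMode u m)) y (Pi.single 0 1) =
        (((R (y 0))⁻¹ * v (y 0) : ℝ) : ℂ) * e (y 1) := fun y hy =>
    lineDeriv_product_fst (f := fun z => (u z : ℂ)) isOpen_Ioo hφ hy (hu _ hy)
  have hd1 : ∀ y : Fin 2 → ℝ, y 0 ∈ Set.Ioo (-Real.pi) Real.pi →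
      lineDeriv ℝ (inCoord (productMode u m)) y (Pi.single 1 1) =
        (u (y 0) : ℂ) * (Complex.I * m * e (y 1)) := fun y hy =>
    lineDeriv_product_snd (f := fun z => (u z : ℂ)) hφ hy (he _)
  have hRC : ∀ z ∈ Set.Ioo (-Real.pi) Real.pi, (R z : ℂ) ≠ 0 := fun z hz =>
    Complex.ofReal_ne_zero.2 (hRz z hz).ne'
  have h00 := lineDeriv_product_fst (g := e)
    (F := fun y => (√(warpedMetric R (y 0)).det * (warpedMetric R (y 0))⁻¹ 0 0) •
      lineDeriv ℝ (inCoord (productMode u m)) y (Pi.single 0 1)) isOpen_Ioo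
    (fun y hy => by
      have := hRC _ hy
      rw [hd0 y hy, sqrt_det_warpedMetric (hRz _ hy), inv_warpedMetric (hRz _ hy)]
      simp [Complex.real_smul]
      field_simp) hx (hv _ hx)
  have h01 := lineDeriv_product_fst (f := fun _ => 0) (g := fun _ => 0)
    (F := fun y => (√(warpedMetric R (y 0)).det * (warpedMetric R (y 0))⁻¹ 0 1) •
      lineDeriv ℝ (inCoord (productMode u m)) y (Pi.single 1 1)) isOpen_Ioo
    (fun y hy => by
      rw [inv_warpedMetric (hRz _ hy)]
      simp) hx (hasDerivAt_const _ _)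
  have h10 := lineDeriv_product_snd (f := fun _ => 0) (g := fun _ => 0)
    (F := fun y => (√(warpedMetric R (y 0)).det * (warpedMetric R (y 0))⁻¹ 1 0) •
      lineDeriv ℝ (inCoord (productMode u m)) y (Pi.single 0 1))
    (fun y hy => by
      rw [inv_warpedMetric (hRz _ hy)]
      simp) hx (hasDerivAt_const _ _)
  have h11 := lineDeriv_product_snd (f := fun z => (R z : ℂ)⁻¹ * u z)
    (g := fun t => Complex.I * m * e t)
    (F := fun y => (√(warpedMetric R (y 0)).det * (warpedMetric R (y 0))⁻¹ 1 1) •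
      lineDeriv ℝ (inCoord (productMode u m)) y (Pi.single 1 1))
    (fun y hy => by
      have := hRC _ hy
      rw [hd1 y hy, sqrt_det_warpedMetric (hRz _ hy), inv_warpedMetric (hRz _ hy)]
      simp [Complex.real_smul]
      field_simp) hx ((he _).const_mul _)
  rw [laplaceBeltrami, Fin.sum_univ_two, Fin.sum_univ_two, Fin.sum_univ_two, h00, h01, h10, h11,
    hφ x hx, sqrt_det_warpedMetric (hRz _ hx), Complex.real_smul]
  have := hRC _ hx
  simp only [radialCoeff]
  push_cast
  field_simp
  linear_combination (m : ℂ) ^ 2 * u (x 0) * e (x 1) * Complex.I_sq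

/-! ### Norms of product modes -/

lemma norm_productMode (u : ℝ → ℝ) (m : ℤ) (x : Cylinder) : ‖productMode u m x‖ = |u x.1| := by
  rw [productMode, norm_mul, fourier_apply, Circle.norm_coe, mul_one, Complex.norm_real,
    Real.norm_eq_abs]

lemma productMode_const_mul (N : ℝ) (u : ℝ → ℝ) (m : ℤ) :
    productMode (fun z => N * u z) m = (N : ℂ) • productMode u m := by
  ext x
  simp [productMode, mul_assoc]

lemma continuous_productMode {u : ℝ → ℝ} (hu : ContinuousOn u (Set.Icc (-Real.pi) Real.pi))
    (m : ℤ) : Continuous (productMode u m) := by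
  have h : Continuous fun z : Set.Icc (-Real.pi) Real.pi => u z :=
    continuousOn_iff_continuous_domRestrict.1 hu
  exact (Complex.continuous_ofReal.comp (h.comp continuous_fst)).mul
    ((map_continuous (fourier m)).comp continuous_snd)

instance isFiniteMeasure_comap_coe_Icc : IsFiniteMeasure
    ((volume : Measure ℝ).comap (Subtype.val : Set.Icc (-Real.pi) Real.pi → ℝ)) := by
  refine ⟨?_⟩
  rw [(MeasurableEmbedding.subtype_coe measurableSet_Icc).comap_apply, Set.image_univ,
    Subtype.range_coe]
  exact measure_Icc_lt_top

lemma continuous_sqrt_det {R : ℝ → ℝ} (hR : ContinuousOn R (Set.Icc (-Real.pi) Real.pi))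
    (hpos : ∀ z ∈ Set.Icc (-Real.pi) Real.pi, 0 < R z) :
    Continuous fun x : Cylinder => √(warpedMetric R (x.1 : ℝ)).det := by
  have h : Continuous fun z : Set.Icc (-Real.pi) Real.pi => R z :=
    continuousOn_iff_continuous_domRestrict.1 hR
  refine (h.comp continuous_fst).congr fun x => ?_
  exact (sqrt_det_warpedMetric (hpos _ x.1.2)).symm

lemma isFiniteMeasure_volumeMeasure {R : ℝ → ℝ}
    (hR : ContinuousOn R (Set.Icc (-Real.pi) Real.pi))
    (hpos : ∀ z ∈ Set.Icc (-Real.pi) Real.pi, 0 < R z) : IsFiniteMeasure (volumeMeasure R) := by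
  refine isFiniteMeasure_withDensity_ofReal ?_
  exact ((continuous_sqrt_det hR hpos).integrable_of_hasCompactSupport
    (HasCompactSupport.of_compactSpace _)).2

lemma volumeMeasure_pos {R : ℝ → ℝ} (hR : ContinuousOn R (Set.Icc (-Real.pi) Real.pi))
    (hpos : ∀ z ∈ Set.Icc (-Real.pi) Real.pi, 0 < R z) {a b : ℝ} (hab : a < b)
    (ha : -Real.pi ≤ a) (hb : b ≤ Real.pi) :
    0 < volumeMeasure R {x | (x.1 : ℝ) ∈ Set.Icc a b} := by
  rw [pos_iff_ne_zero, volumeMeasure, Ne, withDensity_apply_eq_zero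
    (continuous_sqrt_det hR hpos).measurable.ennreal_ofReal]
  have h1 : {x : Cylinder | ENNReal.ofReal (√(warpedMetric R (x.1 : ℝ)).det) ≠ 0} = Set.univ := by
    refine Set.eq_univ_of_forall fun x => ?_
    simp only [Set.mem_ofPred_eq]
    rw [sqrt_det_warpedMetric (hpos _ x.1.2)]
    simpa using hpos _ x.1.2
  have h2 : {x : Cylinder | (x.1 : ℝ) ∈ Set.Icc a b} =
      (Subtype.val ⁻¹' Set.Icc a b : Set (Set.Icc (-Real.pi) Real.pi)) ×ˢ Set.univ := by
    ext x; simp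
  rw [h1, Set.univ_inter, h2, Measure.prod_prod,
    (MeasurableEmbedding.subtype_coe measurableSet_Icc).comap_apply, Subtype.image_preimage_coe,
    Set.inter_eq_right.2 (Set.Icc_subset_Icc ha hb)]
  simp [hab, Real.pi_pos]

/-! ### Exponentially small Cauchy data on the equator -/

lemma ofReal_mul_le_eLpNorm_productMode (μ : Measure Cylinder) {u : ℝ → ℝ} (m : ℤ) {a b K : ℝ}
    (hK : 0 ≤ K) (hu : ∀ z ∈ Set.Icc a b, K ≤ u z) :
    ENNReal.ofReal K * μ {x | (x.1 : ℝ) ∈ Set.Icc a b} ^ (1 / 2 : ℝ) ≤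
      eLpNorm (productMode u m) 2 μ := by
  set S : Set Cylinder := {x | (x.1 : ℝ) ∈ Set.Icc a b}
  have hS : MeasurableSet S :=
    (measurable_subtype_coe.comp measurable_fst) measurableSet_Icc
  have h := eLpNorm_indicator_const (μ := μ) (c := K) hS (p := 2) two_ne_zero ENNReal.ofNat_ne_top
  rw [← Real.enorm_of_nonneg hK]
  refine h.symm.le.trans (eLpNorm_mono fun x => ?_)
  rw [norm_productMode]
  by_cases hx : x ∈ S
  · rw [Set.indicator_of_mem hx, Real.norm_of_nonneg hK]
    exact (hu _ hx).trans (le_abs_self _)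
  · rw [Set.indicator_of_notMem hx, norm_zero]
    exact abs_nonneg _

/-- Normalization of a product mode. The normalizing factor `N` is controlled by a lower bound `K`
for `u` on any subinterval. -/
lemma exists_isNormalizedDirichletEigenfunction {R u v : ℝ → ℝ} {m : ℤ} {μ a b K : ℝ}
    (hR : ContDiffOn ℝ ∞ R (Set.Icc (-Real.pi) Real.pi))
    (hpos : ∀ z ∈ Set.Icc (-Real.pi) Real.pi, 0 < R z) (hμ : 0 ≤ μ)
    (h : IsPlanarSolution (fun z => (R z)⁻¹) (radialCoeff R m μ) Real.pi u v)
    (hleft : u (-Real.pi) = 0) (hright : u Real.pi = 0)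
    (hab : a < b) (ha : -Real.pi ≤ a) (hb : b ≤ Real.pi) (hK : 0 < K)
    (hu : ∀ z ∈ Set.Icc a b, K ≤ u z) :
    ∃ N : ℝ, 0 < N ∧
      N ≤ ((volumeMeasure R {x | (x.1 : ℝ) ∈ Set.Icc a b}).toReal ^ (1 / 2 : ℝ))⁻¹ * K⁻¹ ∧
      IsNormalizedDirichletEigenfunction R (√μ) (productMode (fun z => N * u z) m) := by
  have hfin := isFiniteMeasure_volumeMeasure hR.continuousOn hpos
  have hinv : ContDiffOn ℝ ∞ (fun z => (R z)⁻¹) (Set.Icc (-Real.pi) Real.pi) :=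
    hR.inv fun z hz => (hpos z hz).ne'
  have husm : ContDiffOn ℝ ∞ u (Set.Icc (-Real.pi) Real.pi) :=
    h.contDiffOn_fst hinv ((contDiffOn_const.mul hinv).sub (contDiffOn_const.mul hR))
  set S : Set Cylinder := {x | (x.1 : ℝ) ∈ Set.Icc a b}
  have hS : 0 < (volumeMeasure R S).toReal :=
    ENNReal.toReal_pos (volumeMeasure_pos hR.continuousOn hpos hab ha hb).ne'
      (measure_ne_top _ _)
  have hmem : ∀ w : ℝ → ℝ, ContinuousOn w (Set.Icc (-Real.pi) Real.pi) →
      MemLp (productMode w m) 2 (volumeMeasure R) := fun w hw => by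
    obtain ⟨B, hB⟩ := isCompact_Icc.exists_bound_of_continuousOn hw
    refine MemLp.of_bound (continuous_productMode hw m).aestronglyMeasurable B
      (Eventually.of_forall fun x => ?_)
    rw [norm_productMode]
    exact hB _ x.1.2
  set L := (eLpNorm (productMode u m) 2 (volumeMeasure R)).toReal
  have hLtop := (hmem u husm.continuousOn).eLpNorm_ne_top
  have hL : K * (volumeMeasure R S).toReal ^ (1 / 2 : ℝ) ≤ L := by
    have := ENNReal.toReal_mono hLtop
      (ofReal_mul_le_eLpNorm_productMode (volumeMeasure R) m hK.le hu)
    rwa [ENNReal.toReal_mul, ENNReal.toReal_ofReal hK.le, ← ENNReal.toReal_rpow] at this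
  have hL0 : 0 < L := lt_of_lt_of_le (by positivity) hL
  have hNu : ContDiffOn ℝ ∞ (fun z => L⁻¹ * u z) (Set.Icc (-Real.pi) Real.pi) :=
    contDiffOn_const.mul husm
  have hN : IsPlanarSolution (fun z => (R z)⁻¹) (radialCoeff R m μ) Real.pi
      (fun z => L⁻¹ * u z) (fun z => L⁻¹ * v z) :=
    ⟨fun z hz => by
      convert! (h.deriv_fst z hz).const_mul L⁻¹ using 1; ring, fun z hz => by
      convert! (h.deriv_snd z hz).const_mul L⁻¹ using 1; ring⟩
  have hπ := neg_pi_le_pi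
  refine ⟨L⁻¹, inv_pos.2 hL0, ?_, ⟨contDiffOn_inCoord_productMode hNu m, fun x hx => ?_,
    fun θ => ?_, fun θ => ?_, hmem _ hNu.continuousOn, ?_⟩⟩
  · rw [← mul_inv, mul_comm _ K]
    exact inv_anti₀ (by positivity) hL
  · rw [laplaceBeltrami_productMode hpos hN hx, Real.sq_sqrt hμ]
    ring
  · rw [productMode_point _ _ ⟨le_rfl, hπ⟩, hleft]; simp
  · rw [productMode_point _ _ ⟨hπ, le_rfl⟩, hright]; simp
  · rw [productMode_const_mul, eLpNorm_const_smul, ← ENNReal.ofReal_toReal hLtop]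
    change ‖((L⁻¹ : ℝ) : ℂ)‖ₑ * ENNReal.ofReal L = 1
    rw [← ofReal_norm, Complex.norm_real, Real.norm_of_nonneg (inv_pos.2 hL0).le,
      ← ENNReal.ofReal_mul (inv_pos.2 hL0).le, inv_mul_cancel₀ hL0.ne', ENNReal.ofReal_one]

lemma hasDerivAt_productMode_point {u : ℝ → ℝ} {u' : ℝ} (hu : HasDerivAt u u' 0) (m : ℤ)
    (θ : AddCircle (2 * Real.pi)) :
    HasDerivAt (fun z : ℝ => productMode u m (point z θ)) ((u' : ℂ) * fourier m θ) 0 := by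
  refine (hu.ofReal_comp.mul_const (fourier m θ)).congr_of_eventuallyEq ?_
  filter_upwards [Icc_mem_nhds (neg_lt_zero.2 Real.pi_pos) Real.pi_pos] with z hz
  exact productMode_point u m hz θ

/-- A sequence of eigenfunctions whose Cauchy data on the equator have moduli
`N (|sin θ₀|, |cos θ₀|)` with `N` exponentially small. The angle `θ₀ = π / 2` gives even functions,
`θ₀ = 0` odd ones. -/
theorem exists_eigenfunctions {R : ℝ → ℝ}
    (hR : ContDiffOn ℝ ∞ R (Set.Icc (-Real.pi) Real.pi))
    (hpos : ∀ z ∈ Set.Icc (-Real.pi) Real.pi, 0 < R z)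
    (heven : ∀ z ∈ Set.Icc (-Real.pi) Real.pi, R (-z) = R z)
    (hR_zero : R 0 = 1) (hR_half : R (Real.pi / 2) = √5)
    {θ₀ : ℝ} (hθ₀ : θ₀ = 0 ∨ θ₀ = Real.pi / 2) :
    ∃ C c : ℝ, 0 < C ∧ 0 < c ∧ ∃ (lam : ℕ → ℝ) (φ : ℕ → Cylinder → ℂ),
      Tendsto lam atTop atTop ∧ ∀ j, 0 ≤ lam j ∧
        IsNormalizedDirichletEigenfunction R (lam j) (φ j) ∧
        (∀ z ∈ Set.Icc (-Real.pi) Real.pi, ∀ θ,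
          φ j (point (-z) θ) = -(Real.cos (2 * θ₀) : ℂ) * φ j (point z θ)) ∧
        ∃ N : ℝ, N ≤ C * Real.exp (-c * lam j) ∧
          (∀ θ, ‖trace (φ j) θ‖ = N * |Real.sin θ₀|) ∧
          (∀ θ, ‖normalTrace (φ j) θ‖ = N * |Real.cos θ₀|) := by
  obtain ⟨b, η, ε, δ, hb, hη, hε, hδ, hδ1, m₀, hmodes⟩ :=
    exists_radial_modes hR.continuousOn hpos heven hR_zero hR_half hθ₀
  have hπ := Real.pi_gt_three
  have h0mem : (0 : ℝ) ∈ Set.Icc (-Real.pi) Real.pi := ⟨by linarith, by linarith⟩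
  set V := (volumeMeasure R {x | (x.1 : ℝ) ∈ Set.Icc (2 * δ / 3) δ}).toReal ^ (1 / 2 : ℝ)
  have hfin := isFiniteMeasure_volumeMeasure hR.continuousOn hpos
  have hV : 0 < V := Real.rpow_pos_of_pos (ENNReal.toReal_pos
    (volumeMeasure_pos hR.continuousOn hpos (by linarith) (by linarith) (by linarith)).ne'
    (measure_ne_top _ _)) _
  have key : ∀ j : ℕ, ∃ (lam : ℝ) (φ : Cylinder → ℂ), j / b ≤ lam ∧ 0 ≤ lam ∧
      IsNormalizedDirichletEigenfunction R lam φ ∧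
      (∀ z ∈ Set.Icc (-Real.pi) Real.pi, ∀ θ,
        φ (point (-z) θ) = -(Real.cos (2 * θ₀) : ℂ) * φ (point z θ)) ∧
      ∃ N : ℝ, N ≤ V⁻¹ * η⁻¹ * Real.exp (-(2 * ε) * lam) ∧
        (∀ θ, ‖trace φ θ‖ = N * |Real.sin θ₀|) ∧
        (∀ θ, ‖normalTrace φ θ‖ = N * |Real.cos θ₀|) := by
    intro j
    obtain ⟨μ, hμb, hμ, u, v, hsol, hu0, hv0, huπ, hpar, hgrow⟩ :=
      hmodes (m₀ + j) (Nat.le_add_right _ _)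
    set m : ℕ := m₀ + j
    have hb2 : 0 < b ^ 2 := by positivity
    have hμ0 : 0 ≤ μ := by
      refine nonneg_of_mul_nonneg_left ((sq_nonneg (m : ℝ)).trans hμb) hb2
    have hsol' : IsPlanarSolution (fun z => (R z)⁻¹) (radialCoeff R ((m : ℤ) : ℝ) μ)
        Real.pi u v := by rwa [Int.cast_natCast]
    obtain ⟨N, hN0, hN, hφ⟩ := exists_isNormalizedDirichletEigenfunction hR hpos hμ0 hsol'
      (by rw [hpar _ ⟨by linarith, le_rfl⟩, huπ, mul_zero]) huπ
      (by linarith : 2 * δ / 3 < δ) (by linarith) (by linarith)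
      (by positivity) hgrow
    refine ⟨√μ, _, ?_, Real.sqrt_nonneg _, hφ, fun z hz θ => ?_, N, ?_, fun θ => ?_, fun θ => ?_⟩
    · refine Real.le_sqrt_of_sq_le ?_
      rw [div_pow, div_le_iff₀ hb2]
      refine le_trans (pow_le_pow_left₀ (Nat.cast_nonneg _) ?_ 2) hμb
      exact_mod_cast Nat.le_add_left j m₀
    · rw [productMode_point _ _ hz, productMode_point _ _ ⟨by linarith [hz.2], by linarith [hz.1]⟩,
        hpar z hz]
      push_cast
      ring
    · refine hN.trans ?_
      rw [mul_inv, ← Real.exp_neg, ← mul_assoc]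
      refine mul_le_mul_of_nonneg_left (Real.exp_le_exp.2 ?_) (by positivity)
      -- `λ = √μ ≤ m / 2`
      have : √μ ≤ m / 2 := Real.sqrt_le_iff.2 ⟨by positivity, by rw [div_pow]; linarith⟩
      nlinarith
    · rw [trace, productMode_point _ _ h0mem, hu0, norm_mul, fourier_apply, Circle.norm_coe,
        mul_one, Complex.norm_real, Real.norm_eq_abs, abs_mul, abs_of_pos hN0]
    · have hd := (hsol.deriv_fst 0 h0mem).hasDerivAt
        (Icc_mem_nhds (neg_lt_zero.2 Real.pi_pos) Real.pi_pos)
      rw [hR_zero, hv0, inv_one, one_mul] at hd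
      rw [normalTrace, (hasDerivAt_productMode_point (hd.const_mul N) m θ).deriv, norm_mul,
        fourier_apply, Circle.norm_coe, mul_one, Complex.norm_real, Real.norm_eq_abs, abs_mul,
        abs_of_pos hN0]
  choose lam φ hlam h using key
  exact ⟨V⁻¹ * η⁻¹, 2 * ε, by positivity, by positivity, lam, φ,
    tendsto_atTop_mono hlam (tendsto_natCast_atTop_atTop.atTop_div_const hb), h⟩

lemma eLpNorm_surfaceMeasure_le {R : ℝ → ℝ} (hR_zero : R 0 = 1)
    {f : AddCircle (2 * Real.pi) → ℂ} {B : ℝ} (hf : ∀ θ, ‖f θ‖ ≤ B) :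
    eLpNorm f 2 (surfaceMeasure R) ≤ ENNReal.ofReal ((2 * Real.pi) ^ (2⁻¹ : ℝ) * B) := by
  have hs : surfaceMeasure R = volume := by simp [surfaceMeasure, warpedMetric, hR_zero]
  rw [hs]
  refine (eLpNorm_le_of_ae_bound (Eventually.of_forall hf)).trans_eq ?_
  rw [AddCircle.measure_univ, ENNReal.toReal_ofNat,
    ENNReal.ofReal_rpow_of_nonneg Real.two_pi_pos.le (by norm_num),
    ← ENNReal.ofReal_mul (by positivity)]

end WarpedCylinder

end

theorem proposition1p5 (R : ℝ → ℝ)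
    (hR_smooth : ContDiffOn ℝ ∞ R (Set.Icc (-Real.pi) Real.pi))
    (hR_even : ∀ z ∈ Set.Icc (-Real.pi) Real.pi, R (-z) = R z)
    (hR_pos : ∀ z ∈ Set.Icc 0 Real.pi, 0 < R z)
    (hR_zero : R 0 = 1) (hR_half : R (Real.pi / 2) = √5) (hR_pi : R Real.pi = 1 / √2) :
    ∃ C c : ℝ, 0 < C ∧ 0 < c ∧
      (∃ (lam : ℕ → ℝ) (φ : ℕ → WarpedCylinder.Cylinder → ℂ),
        Tendsto lam atTop atTop ∧
        ∀ j, WarpedCylinder.IsNormalizedDirichletEigenfunction R (lam j) (φ j) ∧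
          (∀ z ∈ Set.Icc (-Real.pi) Real.pi, ∀ θ,
            φ j (WarpedCylinder.point (-z) θ) = φ j (WarpedCylinder.point z θ)) ∧
          (∀ θ, WarpedCylinder.normalTrace (φ j) θ = 0) ∧
          eLpNorm (WarpedCylinder.trace (φ j)) 2 (WarpedCylinder.surfaceMeasure R) ≤
            ENNReal.ofReal (C * Real.exp (-c * lam j))) ∧
      (∃ (lam : ℕ → ℝ) (φ : ℕ → WarpedCylinder.Cylinder → ℂ),
        Tendsto lam atTop atTop ∧
        ∀ j, WarpedCylinder.IsNormalizedDirichletEigenfunction R (lam j) (φ j) ∧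
          (∀ z ∈ Set.Icc (-Real.pi) Real.pi, ∀ θ,
            φ j (WarpedCylinder.point (-z) θ) = -φ j (WarpedCylinder.point z θ)) ∧
          (∀ θ, WarpedCylinder.trace (φ j) θ = 0) ∧
          eLpNorm (WarpedCylinder.normalTrace (φ j)) 2 (WarpedCylinder.surfaceMeasure R) ≤
            ENNReal.ofReal (C * Real.exp (-c * lam j))) := by
  have hpos : ∀ z ∈ Set.Icc (-Real.pi) Real.pi, 0 < R z := fun z hz => by
    rcases le_total 0 z with h | h
    · exact hR_pos z ⟨h, hz.2⟩
    · rw [← hR_even z hz]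
      exact hR_pos (-z) ⟨by linarith, by linarith [hz.1]⟩
  obtain ⟨C₁, c₁, hC₁, hc₁, lam₁, φ₁, hlim₁, h₁⟩ := WarpedCylinder.exists_eigenfunctions
    hR_smooth hpos hR_even hR_zero hR_half (Or.inr rfl)
  obtain ⟨C₂, c₂, hC₂, hc₂, lam₂, φ₂, hlim₂, h₂⟩ := WarpedCylinder.exists_eigenfunctions
    hR_smooth hpos hR_even hR_zero hR_half (Or.inl rfl)
  -- common constants; shrinking `c` weakens the bound because `λ ≥ 0`
  have weaken : ∀ {N C c lam : ℝ}, C ≤ max C₁ C₂ → min c₁ c₂ ≤ c → 0 ≤ lam →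
      N ≤ C * Real.exp (-c * lam) →
      (2 * Real.pi) ^ (2⁻¹ : ℝ) * N ≤
        (2 * Real.pi) ^ (2⁻¹ : ℝ) * max C₁ C₂ * Real.exp (-min c₁ c₂ * lam) := by
    intro N C c lam hC hc hlam hN
    rw [mul_assoc]
    refine mul_le_mul_of_nonneg_left (hN.trans ?_) (by positivity)
    refine mul_le_mul hC (Real.exp_le_exp.2 ?_) (Real.exp_pos _).le (hC₁.le.trans (le_max_left _ _))
    nlinarith
  have hC : 0 < max C₁ C₂ := hC₁.trans_le (le_max_left _ _)
  refine ⟨(2 * Real.pi) ^ (2⁻¹ : ℝ) * max C₁ C₂, min c₁ c₂, by positivity, lt_min hc₁ hc₂,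
    ⟨lam₁, φ₁, hlim₁, fun j => ?_⟩, ⟨lam₂, φ₂, hlim₂, fun j => ?_⟩⟩
  · obtain ⟨hlam, hφ, hpar, N, hN, htr, hntr⟩ := h₁ j
    refine ⟨hφ, fun z hz θ => ?_, fun θ => ?_, ?_⟩
    · rw [hpar z hz θ, mul_div_cancel₀ _ (two_ne_zero' ℝ), Real.cos_pi]
      simp
    · rw [← norm_eq_zero, hntr, Real.cos_pi_div_two, abs_zero, mul_zero]
    · refine (WarpedCylinder.eLpNorm_surfaceMeasure_le hR_zero fun θ => (htr θ).le).trans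
        (ENNReal.ofReal_le_ofReal ?_)
      rw [Real.sin_pi_div_two, abs_one, mul_one]
      exact weaken (le_max_left _ _) (min_le_left _ _) hlam hN
  · obtain ⟨hlam, hφ, hpar, N, hN, htr, hntr⟩ := h₂ j
    refine ⟨hφ, fun z hz θ => ?_, fun θ => ?_, ?_⟩
    · rw [hpar z hz θ, mul_zero, Real.cos_zero]
      simp
    · rw [← norm_eq_zero, htr, Real.sin_zero, abs_zero, mul_zero]
    · refine (WarpedCylinder.eLpNorm_surfaceMeasure_le hR_zero fun θ => (hntr θ).le).trans
        (ENNReal.ofReal_le_ofReal ?_)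
      rw [Real.cos_zero, abs_one, mul_one]
      exact weaken (le_max_right _ _) (min_le_right _ _) hlam hN
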